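/- Let $I\subseteq\mathbb R$ be a nonempty open interval, $U\subseteq\mathbb R^3$ a nonempty connected open set (for example $U=\mathbb R^3$), and $M=I\times U$ with coordinates $(t,x^1,x^2,x^3)=(t,x,y,z)$. A proper diagonal Bianchi I metric on $M$ is a metric $$ds^2=-dt^2+\sum_{\mu=1}^3A_\mu(t)^2(dx^\mu)^2$$ with $A_\mu$ smooth, nowhere zero and pairwise different on $I$, such that the isometries acting on the hypersurfaces $t=\mathrm{const}$ have dimension three, i.e. each Killing vector field of $M$ tangent to these hypersurfaces is a linear combination with constant coefficients of $\partial_x,\partial_y,\partial_z$. A proper homothetic vector field (HVF) of a metric $g$ with homothetic factor $\phi$ is a smooth vector field $Y$ on $M$ with $\mathcal L_Yg=2\phi g$, where $\phi\neq0$ is a constant. **Proposition 1 (HVF).** The only proper diagonal Bianchi I space-times admitting a proper HVF are the Kasner-type metrics $$ds^2=-dt^2+t^{2\frac{\phi-a}{\phi}}dx^2+t^{2\frac{\phi-b}{\phi}}dy^2+t^{2\frac{\phi-c}{\phi}}dz^2\quad(t>0),\qquad a,b,c\ \text{distinct},\tag{1}$$ and the HVF is $$Y=\phi t\,\partial_t+ax\,\partial_x+by\,\partial_y+cz\,\partial_z,\tag{2}$$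 with homothetic factor $\phi$. Precisely: (i) If a proper diagonal Bianchi I metric on $M$ admits a proper HVF $Y$ with homothetic factor $\phi$, then there are distinct real numbers $a,b,c$ and a change of coordinates $t'=\pm(t-t_0)$, $x'^\mu=k_\mu x^\mu$ with constants $t_0\in\mathbb R$ and $k_\mu>0$, such that $t'>0$ on $M$, the metric has the form (1) in the coordinates $(t',x',y',z')$, and $Y$ is the sum of the vector field (2) in these coordinates and a linear combination with constant coefficients of $\partial_{x'},\partial_{y'},\partial_{z'}$. (ii) Conversely, for all $\phi\neq0$ and all distinct real $a,b,c$, the metric (1) on $M=I\times U$ with $I\subseteq(0,\infty)$ is a proper diagonal Bianchi I metric, the vector field (2) is a proper HVF of it with homothetic factor $\phi$, and each proper HVF of it, with homothetic factor $\psi$ say, is the sum of $\frac{\psi}{\phi}Y$ and a linear combination with constant coefficients of $\partial_x,\partial_y,\partial_z$. -/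

import Mathlib

open scoped ContDiff

noncomputable section

namespace BianchiI

/-- Coordinates `(t, x, y, z)`: the entry `0` is the time `t`, the entries `1, 2, 3` (that is,
`μ.succ` for `μ : Fin 3`) are the spatial coordinates. -/
abbrev Coord : Type := Fin 4 → ℝ

/-- The components `g_{ab}` of a field of bilinear forms, as functions of the coordinates. -/
abbrev MetricField : Type := Coord → Matrix (Fin 4) (Fin 4) ℝ

/-- The components `Y^a` of a vector field, as functions of the coordinates. -/
abbrev VField : Type := Coord → Coord

/-- Partial derivative `∂_c f` at `p`. -/
def pd (c : Fin 4) (f : Coord → ℝ) (p : Coord) : ℝ := fderiv ℝ f p (Pi.single c 1)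

/-- Lie derivative `(L_Y g)_{ab} = Y^c ∂_c g_{ab} + g_{cb} ∂_a Y^c + g_{ac} ∂_b Y^c`. -/
def lieDeriv (Y : VField) (g : MetricField) (p : Coord) : Matrix (Fin 4) (Fin 4) ℝ :=
  Matrix.of fun a b =>
    ∑ c, (Y p c * pd c (fun q => g q a b) p
      + g p c b * pd a (fun q => Y q c) p
      + g p a c * pd b (fun q => Y q c) p)

/-- `Y` is a smooth vector field on the region `M` with `L_Y g = 2 φ g` there, `φ` a constant:
a homothetic vector field with homothetic factor `φ`. -/
def IsHVF (M : Set Coord) (g : MetricField) (Y : VField) (φ : ℝ) : Prop :=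
  ContDiffOn ℝ ∞ Y M ∧ ∀ p ∈ M, lieDeriv Y g p = (2 * φ) • g p

/-- A homothetic vector field is proper if it is not a Killing vector field. -/
def IsProperHVF (M : Set Coord) (g : MetricField) (Y : VField) (φ : ℝ) : Prop :=
  IsHVF M g Y φ ∧ φ ≠ 0

/-- Killing vector fields. -/
def IsKilling (M : Set Coord) (g : MetricField) (Y : VField) : Prop := IsHVF M g Y 0

/-- The region `I × U` of space-time: `t ∈ I`, `(x, y, z) ∈ U`. -/
def region (I : Set ℝ) (U : Set (Fin 3 → ℝ)) : Set Coord :=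
  {p | p 0 ∈ I ∧ (fun μ : Fin 3 => p μ.succ) ∈ U}

/-- Admissible coordinate ranges: `I` is a nonempty open interval (possibly unbounded) and `U` is
a nonempty connected open subset of `ℝ³`, for example `ℝ³` itself. -/
structure IsAdmissible (I : Set ℝ) (U : Set (Fin 3 → ℝ)) : Prop where
  isOpen_time : IsOpen I
  isConnected_time : IsConnected I
  isOpen_space : IsOpen U
  isConnected_space : IsConnected U

/-- The metric `-dt² + A₁(t)² dx² + A₂(t)² dy² + A₃(t)² dz²`. -/
def diagMetric (A : Fin 3 → ℝ → ℝ) : MetricField := fun p =>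
  Matrix.diagonal (Fin.cons (-1) fun μ => A μ (p 0) ^ 2)

/-- The vector field `s₁ ∂_x + s₂ ∂_y + s₃ ∂_z` with constant components. -/
def translation (s : Fin 3 → ℝ) : Coord := Fin.cons 0 s

/-- `g` is, on `I × U`, a proper diagonal Bianchi I metric in synchronous coordinates: it is
`-dt² + ∑ A_μ(t)² (dx^μ)²` with smooth nowhere vanishing, pairwise different metric functions, and
the isometries acting on the hypersurfaces `t = const` form a group of dimension three only:
each Killing vector field tangent to them is a linear combination of `∂_x, ∂_y, ∂_z`. -/
structure IsProperDiagonal (I : Set ℝ) (U : Set (Fin 3 → ℝ)) (g : MetricField) : Prop where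
  admissible : IsAdmissible I U
  exists_metric_functions : ∃ A : Fin 3 → ℝ → ℝ,
    (∀ μ, ContDiffOn ℝ ∞ (A μ) I) ∧ (∀ μ, ∀ t ∈ I, A μ t ≠ 0) ∧
    (∀ μ ν, μ ≠ ν → ¬ Set.EqOn (A μ) (A ν) I) ∧
    ∀ p ∈ region I U, g p = diagMetric A p
  killing_tangent : ∀ X : VField, IsKilling (region I U) g X → (∀ p ∈ region I U, X p 0 = 0) →
    ∃ s : Fin 3 → ℝ, ∀ p ∈ region I U, X p = translation s

/-- The Kasner-type metric `-dt² + ∑ t^{2(φ - a_μ)/φ} (dx^μ)²`; it is used for `t > 0`. -/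
def kasnerMetric (φ : ℝ) (a : Fin 3 → ℝ) : MetricField := fun p =>
  Matrix.diagonal (Fin.cons (-1) fun μ => (p 0) ^ (2 * ((φ - a μ) / φ)))

/-- The vector field `φ t ∂_t + a₁ x ∂_x + a₂ y ∂_y + a₃ z ∂_z`. -/
def kasnerHVF (φ : ℝ) (a : Fin 3 → ℝ) : VField := fun p =>
  Fin.cons (φ * p 0) fun μ => a μ * p μ.succ

/-- The change of coordinates `t' = ε (t - t₀)`, `x'^μ = k_μ x^μ`. -/
def coordChange (ε t₀ : ℝ) (k : Fin 3 → ℝ) (p : Coord) : Coord :=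
  Fin.cons (ε * (p 0 - t₀)) fun μ => k μ * p μ.succ

/-- The pullback `(Φ^* g)_{ab} = g_{cd} ∂_a Φ^c ∂_b Φ^d`. -/
def pullback (Φ : Coord → Coord) (g : MetricField) : MetricField := fun p =>
  Matrix.of fun a b =>
    ∑ c, ∑ d, g (Φ p) c d * pd a (fun q => Φ q c) p * pd b (fun q => Φ q d) p

end BianchiI

end

/-! Write `b_μ = A_μ²`. The condition on Killing fields enters through one consequence: no two `b_μ`
are proportional, because `b_μ = C b_ν` would make the rotation `x^ν ∂_μ - C x^μ ∂_ν` a Killing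
field (`not_proportional_of_killing_tangent`).

The main step, `pd_time_eq_zero`, is that `Y⁰` depends on `t` only. Fix `ν` and put `w = ∂_ν Y⁰`,
`T_μ = ∂_μ² w`; both are independent of `t` since `∂_t Y⁰ = φ`. Differentiating the homothetic
equations gives `(b_μ'' b_ν - b_μ' b_ν') w = 2 T_μ b_ν` for `μ ≠ ν` and `(b_μ'' b_μ - b_μ'²) w = -2
T_μ b_μ`. For `φ ≠ 0` also `b_μ'' w = 2 T_μ` (`second_deriv_mul_pd`), hence `b_μ' b_ν' w = 0` for `μ
≠ ν` and `b_μ'² w = 4 T_μ b_μ`. If `w ≠ 0` at some point, these force two of the `b_μ` to be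
constant, hence proportional.

Now `∂_t Y^μ = 0`, and non-proportionality kills the off-diagonal `∂_ν Y^μ`. So `Y⁰ = φ t + r`, `Y^μ
= a_μ x^μ + s_μ` and `(φ t + r) b_μ' = 2 (φ - a_μ) b_μ` (`exists_affine`). Equal `a_μ` would give
proportional `b_μ`; distinct ones keep the zero `t₀` of `φ t + r` out of `I`, and the `b_μ` are
multiples of powers of `|t - t₀|`.

Conversely, powers with distinct exponents are not proportional, so the same affine form holds for
the tangent Killing fields and the proper HVFs of a Kasner-type metric, and the equation for `b_μ`
determines their coefficients. -/

namespace BianchiI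

/-! ### Partial derivatives -/

section PartialDerivatives

variable {M : Set Coord} {F G : Coord → ℝ} {p : Coord}

lemma pd_congr (hM : IsOpen M) (h : ∀ q ∈ M, F q = G q) (hp : p ∈ M) (c : Fin 4) :
    pd c F p = pd c G p := by
  have : F =ᶠ[nhds p] G := Filter.eventuallyEq_of_mem (hM.mem_nhds hp) h
  simp only [pd, this.fderiv_eq]

lemma differentiableAt_of_smooth (hM : IsOpen M) (hF : ContDiffOn ℝ ∞ F M) (hp : p ∈ M) :
    DifferentiableAt ℝ F p :=
  (hF.contDiffAt (hM.mem_nhds hp)).differentiableAt (by simp)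

lemma contDiffOn_pd (hM : IsOpen M) (hF : ContDiffOn ℝ ∞ F M) (c : Fin 4) :
    ContDiffOn ℝ ∞ (pd c F) M :=
  (hF.fderiv_of_isOpen hM (m := ∞) (by simp)).clm_apply contDiffOn_const

lemma pd_add (hF : DifferentiableAt ℝ F p) (hG : DifferentiableAt ℝ G p) (c : Fin 4) :
    pd c (fun q => F q + G q) p = pd c F p + pd c G p := by
  simp only [pd]
  rw [fderiv_fun_add hF hG]
  rfl

lemma pd_mul (hF : DifferentiableAt ℝ F p) (hG : DifferentiableAt ℝ G p) (c : Fin 4) :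
    pd c (fun q => F q * G q) p = pd c F p * G p + F p * pd c G p := by
  simp only [pd]
  rw [fderiv_fun_mul hF hG]
  simp
  ring

lemma pd_const_mul (hF : DifferentiableAt ℝ F p) (r : ℝ) (c : Fin 4) :
    pd c (fun q => r * F q) p = r * pd c F p := by
  simp only [pd]
  rw [fderiv_const_mul hF]
  simp

@[simp] lemma pd_const (r : ℝ) (c : Fin 4) : pd c (fun _ => r) p = 0 := by simp [pd]

lemma pd_coord (c d : Fin 4) : pd c (fun q => q d) p = if d = c then 1 else 0 := by
  simp only [pd]
  rw [(hasFDerivAt_apply d p).fderiv]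
  simp [Pi.single_apply]

lemma pd_time {b : ℝ → ℝ} (hb : DifferentiableAt ℝ b (p 0)) (c : Fin 4) :
    pd c (fun q => b (q 0)) p = if c = 0 then deriv b (p 0) else 0 := by
  have h := hb.hasDerivAt.comp_hasFDerivAt p (hasFDerivAt_apply (𝕜 := ℝ) (0 : Fin 4) p)
  simp only [pd]
  rw [show (fun q : Coord => b (q 0)) = b ∘ fun q => q 0 from rfl, h.fderiv]
  by_cases hc : c = 0 <;> simp [hc, eq_comm]

lemma pd_comm (hM : IsOpen M) (hF : ContDiffOn ℝ ∞ F M) (hp : p ∈ M) (c d : Fin 4) :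
    pd c (pd d F) p = pd d (pd c F) p := by
  have hs : IsSymmSndFDerivAt ℝ F p :=
    (hF.contDiffAt (hM.mem_nhds hp)).isSymmSndFDerivAt (by simpa using WithTop.coe_le_coe.2 (le_top : (2 : ℕ∞) ≤ ⊤))
  have hd : DifferentiableAt ℝ (fderiv ℝ F) p :=
    ((hF.fderiv_of_isOpen hM (m := ∞) (by simp)).contDiffAt (hM.mem_nhds hp)).differentiableAt
      (by simp)
  have key : ∀ c d : Fin 4, pd c (pd d F) p =
      fderiv ℝ (fderiv ℝ F) p (Pi.single c 1) (Pi.single d 1) := by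
    intro c d
    change fderiv ℝ (fun q => fderiv ℝ F q (Pi.single d 1)) p (Pi.single c 1) = _
    rw [fderiv_clm_apply hd (differentiableAt_const _)]
    simp
  rw [key, key, hs]

lemma fderiv_eq_zero_of_pd (h : ∀ c, pd c F p = 0) : fderiv ℝ F p = 0 := by
  refine ContinuousLinearMap.coe_injective (LinearMap.pi_ext' fun c => LinearMap.ext_ring ?_)
  simpa [pd] using h c

end PartialDerivatives

/-! ### Space-time regions -/

section Regions

variable {I : Set ℝ} {U : Set (Fin 3 → ℝ)}

lemma IsAdmissible.isOpen_region (h : IsAdmissible I U) : IsOpen (region I U) :=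
  (h.isOpen_time.preimage (continuous_apply 0)).inter
    (h.isOpen_space.preimage (by fun_prop : Continuous fun (p : Coord) (μ : Fin 3) => p μ.succ))

lemma cons_mem_region {t : ℝ} {x : Fin 3 → ℝ} (ht : t ∈ I) (hx : x ∈ U) :
    (Fin.cons t x : Coord) ∈ region I U := ⟨by simpa using ht, by simpa using hx⟩

lemma IsAdmissible.isPreconnected_region (h : IsAdmissible I U) :
    IsPreconnected (region I U) := by
  have hc : Continuous fun q : ℝ × (Fin 3 → ℝ) => (Fin.cons q.1 q.2 : Coord) := by
    refine continuous_pi fun c => ?_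
    refine Fin.cases ?_ (fun μ => ?_) c
    · simpa using continuous_fst
    · simp only [Fin.cons_succ]
      fun_prop
  convert (h.isConnected_time.isPreconnected.prod h.isConnected_space.isPreconnected).image _
    hc.continuousOn using 1
  ext p
  constructor
  · rintro ⟨h0, h1⟩
    exact ⟨(p 0, fun μ => p μ.succ), ⟨h0, h1⟩, Fin.cons_self_tail p⟩
  · rintro ⟨⟨t, x⟩, ⟨ht, hx⟩, rfl⟩
    exact cons_mem_region ht hx

lemma IsAdmissible.eq_of_pd_eq_zero (h : IsAdmissible I U) {F : Coord → ℝ}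
    (hF : ContDiffOn ℝ ∞ F (region I U)) (h0 : ∀ p ∈ region I U, ∀ c, pd c F p = 0)
    {p q : Coord} (hp : p ∈ region I U) (hq : q ∈ region I U) : F p = F q :=
  h.isOpen_region.is_const_of_fderiv_eq_zero h.isPreconnected_region
    (hF.differentiableOn (by simp)) (fun p hp => fderiv_eq_zero_of_pd (h0 p hp)) hp hq

/-- A function with vanishing time derivative does not depend on time. -/
lemma IsAdmissible.eq_cons_of_pd_zero (h : IsAdmissible I U) {F : Coord → ℝ}
    (hF : ContDiffOn ℝ ∞ F (region I U)) (h0 : ∀ p ∈ region I U, pd 0 F p = 0)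
    {x : Fin 3 → ℝ} (hx : x ∈ U) {s t : ℝ} (hs : s ∈ I) (ht : t ∈ I) :
    F (Fin.cons s x) = F (Fin.cons t x) := by
  have hd : ∀ t ∈ I, HasDerivAt (fun t => F (Fin.cons t x)) 0 t := by
    intro t ht
    have hp := cons_mem_region ht hx
    have hc : HasDerivAt (fun t : ℝ => (Fin.cons t x : Coord)) (Pi.single 0 1) t := by
      rw [hasDerivAt_pi]
      intro c
      refine Fin.cases ?_ (fun μ => ?_) c
      · simpa using hasDerivAt_id' t
      · simpa using hasDerivAt_const t (x μ)
    have := (differentiableAt_of_smooth h.isOpen_region hF hp).hasFDerivAt.comp_hasDerivAt t hc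
    rwa [show fderiv ℝ F (Fin.cons t x) (Pi.single 0 1) = 0 from h0 _ hp] at this
  exact h.isOpen_time.is_const_of_deriv_eq_zero h.isConnected_time.isPreconnected
    (fun t ht => (hd t ht).differentiableAt.differentiableWithinAt)
    (fun t ht => (hd t ht).deriv) hs ht

end Regions

/-! ### The homothetic equations -/

/-- The metric `-dt² + ∑ b_μ(t) (dx^μ)²`. -/
def warpedMetric (b : Fin 3 → ℝ → ℝ) : MetricField := fun p =>
  Matrix.diagonal (Fin.cons (-1) fun μ => b μ (p 0))

/-- The Lie derivative contains derivatives of the metric, so agreement near each point is needed;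
openness of `M` provides it. -/
lemma isHVF_congr {M : Set Coord} (hM : IsOpen M) {g g' : MetricField}
    (h : ∀ p ∈ M, g p = g' p) {Y : VField} {φ : ℝ} : IsHVF M g Y φ ↔ IsHVF M g' Y φ := by
  refine and_congr_right fun _ => forall₂_congr fun p hp => ?_
  have : lieDeriv Y g p = lieDeriv Y g' p := by
    ext i j
    simp only [lieDeriv, Matrix.of_apply]
    refine Finset.sum_congr rfl fun c _ => ?_
    rw [pd_congr hM (fun q hq => by rw [h q hq]) hp c, h p hp]
  rw [this, h p hp]

/-- The homothetic equations, componentwise, for a metric `-dt² + ∑ b_μ(t) (dx^μ)²`. -/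
structure HomotheticEqs (M : Set Coord) (b : Fin 3 → ℝ → ℝ) (Y : VField) (φ : ℝ) : Prop where
  smooth : ∀ c, ContDiffOn ℝ ∞ (fun q => Y q c) M
  time_time : ∀ p ∈ M, pd 0 (fun q => Y q 0) p = φ
  time_space : ∀ p ∈ M, ∀ μ : Fin 3,
    pd μ.succ (fun q => Y q 0) p = b μ (p 0) * pd 0 (fun q => Y q μ.succ) p
  space_space : ∀ p ∈ M, ∀ μ ν : Fin 3, μ ≠ ν →
    b μ (p 0) * pd ν.succ (fun q => Y q μ.succ) p +
      b ν (p 0) * pd μ.succ (fun q => Y q ν.succ) p = 0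
  space_diag : ∀ p ∈ M, ∀ μ : Fin 3,
    Y p 0 * deriv (b μ) (p 0) + 2 * (b μ (p 0) * pd μ.succ (fun q => Y q μ.succ) p) =
      2 * φ * b μ (p 0)

lemma lieDeriv_warpedMetric {b : Fin 3 → ℝ → ℝ} {p : Coord}
    (hb : ∀ μ, DifferentiableAt ℝ (b μ) (p 0)) (Y : VField) (i j : Fin 4) :
    lieDeriv Y (warpedMetric b) p i j =
      (if i = j then Y p 0 * (Fin.cons 0 fun μ => deriv (b μ) (p 0) : Coord) i else 0) +
        (Fin.cons (-1) fun μ => b μ (p 0) : Coord) j * pd i (fun q => Y q j) p +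
        (Fin.cons (-1) fun μ => b μ (p 0) : Coord) i * pd j (fun q => Y q i) p := by
  have h1 : ∀ c, pd c (fun q => warpedMetric b q i j) p =
      if c = 0 then (if i = j then (Fin.cons 0 fun μ => deriv (b μ) (p 0) : Coord) i else 0)
        else 0 := by
    intro c
    by_cases hij : i = j
    · subst hij
      refine Fin.cases ?_ (fun μ => ?_) i
      · simp [warpedMetric]
      · simp [warpedMetric, pd_time (hb μ)]
    · simp [warpedMetric, hij]
  simp only [lieDeriv, Matrix.of_apply, Finset.sum_add_distrib, h1]
  simp [warpedMetric, Matrix.diagonal_apply]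

lemma isHVF_warpedMetric_iff {M : Set Coord} {b : Fin 3 → ℝ → ℝ}
    (hb : ∀ p ∈ M, ∀ μ, DifferentiableAt ℝ (b μ) (p 0)) {Y : VField} {φ : ℝ} :
    IsHVF M (warpedMetric b) Y φ ↔ HomotheticEqs M b Y φ := by
  constructor
  · rintro ⟨hY, h⟩
    have h' : ∀ p ∈ M, ∀ i j, lieDeriv Y (warpedMetric b) p i j =
        2 * φ * warpedMetric b p i j := fun p hp i j => by rw [h p hp]; simp
    refine ⟨contDiffOn_pi.1 hY, fun p hp => ?_, fun p hp μ => ?_, fun p hp μ ν hμν => ?_,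
      fun p hp μ => ?_⟩
    · have := h' p hp 0 0
      rw [lieDeriv_warpedMetric (hb p hp)] at this
      simp [warpedMetric] at this
      linarith
    · have := h' p hp 0 μ.succ
      rw [lieDeriv_warpedMetric (hb p hp)] at this
      simp [warpedMetric, (Fin.succ_ne_zero μ).symm] at this
      linarith
    · have := h' p hp μ.succ ν.succ
      rw [lieDeriv_warpedMetric (hb p hp)] at this
      simp [warpedMetric, hμν] at this
      linarith
    · have := h' p hp μ.succ μ.succ
      rw [lieDeriv_warpedMetric (hb p hp)] at this
      simp [warpedMetric] at this
      linarith
  · intro h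
    refine ⟨contDiffOn_pi.2 h.smooth, fun p hp => ?_⟩
    ext i j
    rw [lieDeriv_warpedMetric (hb p hp)]
    have h00 := h.time_time p hp
    refine Fin.cases ?_ (fun μ => ?_) i <;> refine Fin.cases ?_ (fun ν => ?_) j
    · simp [warpedMetric]
      linarith
    · have := h.time_space p hp ν
      simp [warpedMetric, (Fin.succ_ne_zero ν).symm]
      linarith
    · have := h.time_space p hp μ
      simp [warpedMetric]
      linarith
    · by_cases hμν : μ = ν
      · subst hμν
        have := h.space_diag p hp μ
        simp [warpedMetric]
        linarith
      · have := h.space_space p hp μ ν hμν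
        simp [warpedMetric, hμν]
        linarith

/-! ### Rigidity of homothetic vector fields -/

section Rigidity

variable {I : Set ℝ} {U : Set (Fin 3 → ℝ)} {b : Fin 3 → ℝ → ℝ} {Y : VField} {φ : ℝ}

lemma contDiffOn_time {c : ℝ → ℝ} (hc : ContDiffOn ℝ ∞ c I) :
    ContDiffOn ℝ ∞ (fun q : Coord => c (q 0)) (region I U) :=
  hc.comp (contDiff_apply ℝ ℝ (0 : Fin 4)).contDiffOn fun _ hp => hp.1

namespace HomotheticEqs

/-- `∂_t` commutes with `∂_c`, and `∂_t Y⁰` is the constant `φ`. Time independence of the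
derivatives of `Y⁰` is what makes time differentiation effective below. -/
lemma pd_zero_pd_time (h : IsAdmissible I U) (E : HomotheticEqs (region I U) b Y φ)
    (c : Fin 4) {p : Coord} (hp : p ∈ region I U) : pd 0 (pd c fun q => Y q 0) p = 0 := by
  rw [pd_comm h.isOpen_region (E.smooth 0) hp, pd_congr h.isOpen_region E.time_time hp, pd_const]

variable (h : IsAdmissible I U) (hb : ∀ μ, ContDiffOn ℝ ∞ (b μ) I)
  (E : HomotheticEqs (region I U) b Y φ)

include h hb E

/-- The derivative of `space_diag` in another spatial direction. -/
lemma pd_space_diag {μ ν : Fin 3} {p : Coord} (hp : p ∈ region I U) :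
    deriv (b μ) (p 0) * pd ν.succ (fun q => Y q 0) p +
      2 * (b μ (p 0) * pd ν.succ (pd μ.succ fun q => Y q μ.succ) p) = 0 := by
  have hM := h.isOpen_region
  have sv := contDiffOn_pd hM (E.smooth μ.succ) μ.succ
  have sb := contDiffOn_time (U := U) (hb μ)
  have sb' := contDiffOn_time (U := U) ((hb μ).deriv_of_isOpen h.isOpen_time (m := ∞) (by simp))
  have D : ∀ {F : Coord → ℝ}, ContDiffOn ℝ ∞ F (region I U) → DifferentiableAt ℝ F p :=
    fun hF => differentiableAt_of_smooth hM hF hp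
  have e := pd_congr hM (fun q hq => E.space_diag q hq μ) hp ν.succ
  have d1 : DifferentiableAt ℝ (b μ) (p 0) :=
    ((hb μ).contDiffAt (h.isOpen_time.mem_nhds hp.1)).differentiableAt (by simp)
  have d2 : DifferentiableAt ℝ (deriv (b μ)) (p 0) :=
    (((hb μ).deriv_of_isOpen h.isOpen_time (m := ∞) (by simp)).contDiffAt
      (h.isOpen_time.mem_nhds hp.1)).differentiableAt (by simp)
  rw [pd_add ((D (E.smooth 0)).fun_mul (D sb')) (((D sb).fun_mul (D sv)).const_mul 2),
    pd_mul (D (E.smooth 0)) (D sb'), pd_const_mul ((D sb).fun_mul (D sv)), pd_mul (D sb) (D sv),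
    pd_const_mul (D sb), pd_time d1, pd_time d2, if_neg (Fin.succ_ne_zero ν),
    if_neg (Fin.succ_ne_zero ν)] at e
  linarith

/-- The relation obtained from `space_space` and `space_diag` by differentiation. -/
lemma deriv_mul_pd {μ ν : Fin 3} (hμν : μ ≠ ν) {p : Coord}
    (hp : p ∈ region I U) :
    deriv (b μ) (p 0) * pd ν.succ (fun q => Y q 0) p =
      2 * (b ν (p 0) * pd μ.succ (pd μ.succ fun q => Y q ν.succ) p) := by
  have hM := h.isOpen_region
  have s1 := contDiffOn_pd hM (E.smooth μ.succ) ν.succ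
  have s2 := contDiffOn_pd hM (E.smooth ν.succ) μ.succ
  have D : ∀ {F : Coord → ℝ}, ContDiffOn ℝ ∞ F (region I U) → DifferentiableAt ℝ F p :=
    fun hF => differentiableAt_of_smooth hM hF hp
  have d : ∀ μ, DifferentiableAt ℝ (b μ) (p 0) := fun μ =>
    ((hb μ).contDiffAt (h.isOpen_time.mem_nhds hp.1)).differentiableAt (by simp)
  have sb := fun μ => contDiffOn_time (U := U) (hb μ)
  -- The mixed derivative `∂_μ ∂_ν Y^μ` that appears here is expressed through `∂_ν Y⁰` by
  -- `pd_space_diag`.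
  have e := pd_congr hM (fun q hq => E.space_space q hq μ ν hμν) hp μ.succ
  rw [pd_add ((D (sb μ)).fun_mul (D s1)) ((D (sb ν)).fun_mul (D s2)), pd_mul (D (sb μ)) (D s1),
    pd_mul (D (sb ν)) (D s2), pd_time (d μ), pd_time (d ν), if_neg (Fin.succ_ne_zero μ),
    if_neg (Fin.succ_ne_zero μ), pd_const, pd_comm hM (E.smooth μ.succ) hp μ.succ ν.succ] at e
  have := E.pd_space_diag h hb (μ := μ) (ν := ν) hp
  linarith

/-- Second derivatives of `time_space`. -/
lemma pd_pd_time_space (c d : Fin 3) (ν : Fin 3) {p : Coord} (hp : p ∈ region I U) :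
    pd c.succ (pd d.succ (pd ν.succ fun q => Y q 0)) p =
      b ν (p 0) * pd 0 (pd c.succ (pd d.succ fun q => Y q ν.succ)) p := by
  have hM := h.isOpen_region
  have sv := contDiffOn_pd hM (E.smooth ν.succ) 0
  have sb := contDiffOn_time (U := U) (hb ν)
  have d1 : ∀ q ∈ region I U, DifferentiableAt ℝ (b ν) (q 0) := fun q hq =>
    ((hb ν).contDiffAt (h.isOpen_time.mem_nhds hq.1)).differentiableAt (by simp)
  have key : ∀ (c : Fin 3) {F : Coord → ℝ}, ContDiffOn ℝ ∞ F (region I U) → ∀ q ∈ region I U,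
      pd c.succ (fun q => b ν (q 0) * F q) q = b ν (q 0) * pd c.succ F q := by
    intro c F hF q hq
    rw [pd_mul (differentiableAt_of_smooth hM sb hq) (differentiableAt_of_smooth hM hF hq),
      pd_time (d1 q hq), if_neg (Fin.succ_ne_zero c)]
    ring
  have e1 : ∀ q ∈ region I U, pd d.succ (pd ν.succ fun q => Y q 0) q =
      b ν (q 0) * pd d.succ (pd 0 fun q => Y q ν.succ) q := fun q hq => by
    rw [pd_congr hM (fun q hq => E.time_space q hq ν) hq, key d sv q hq]
  rw [pd_congr hM e1 hp, key c (contDiffOn_pd hM sv _) p hp,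
    pd_comm hM (contDiffOn_pd hM (E.smooth ν.succ) _) hp 0 c.succ,
    pd_congr hM (fun q hq => pd_comm hM (E.smooth ν.succ) hq 0 d.succ) hp]

lemma pd_time_space (d ν : Fin 3) {p : Coord} (hp : p ∈ region I U) :
    pd d.succ (pd ν.succ fun q => Y q 0) p =
      b ν (p 0) * pd 0 (pd d.succ fun q => Y q ν.succ) p := by
  have hM := h.isOpen_region
  have sv := contDiffOn_pd hM (E.smooth ν.succ) 0
  have sb := contDiffOn_time (U := U) (hb ν)
  rw [pd_congr hM (fun q hq => E.time_space q hq ν) hp,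
    pd_mul (differentiableAt_of_smooth hM sb hp) (differentiableAt_of_smooth hM sv hp),
    pd_time (((hb ν).contDiffAt (h.isOpen_time.mem_nhds hp.1)).differentiableAt (by simp)),
    if_neg (Fin.succ_ne_zero d), pd_comm hM (E.smooth ν.succ) hp 0 d.succ]
  ring

-- Brings the third derivative produced by `pd_space_diag` to the form occurring in
-- `second_deriv_cross`, so that the two relations can be compared.
omit hb in
lemma pd_rotate (μ ν : Fin 3) {p : Coord} (hp : p ∈ region I U) :
    pd ν.succ (pd μ.succ (pd μ.succ fun q => Y q 0)) p =
      pd μ.succ (pd μ.succ (pd ν.succ fun q => Y q 0)) p := by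
  have hM := h.isOpen_region
  rw [pd_comm hM (contDiffOn_pd hM (E.smooth 0) _) hp,
    pd_congr hM (fun q hq => pd_comm hM (E.smooth 0) hq ν.succ μ.succ) hp]

/-- Time derivative of `deriv_mul_pd`. -/
lemma second_deriv_cross {μ ν : Fin 3} (hμν : μ ≠ ν)
    {p : Coord} (hp : p ∈ region I U) :
    (deriv (deriv (b μ)) (p 0) * b ν (p 0) - deriv (b μ) (p 0) * deriv (b ν) (p 0)) *
        pd ν.succ (fun q => Y q 0) p =
      2 * pd μ.succ (pd μ.succ (pd ν.succ fun q => Y q 0)) p * b ν (p 0) := by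
  have hM := h.isOpen_region
  have sw := contDiffOn_pd hM (E.smooth 0) ν.succ
  have sv := contDiffOn_pd hM (contDiffOn_pd hM (E.smooth ν.succ) μ.succ) μ.succ
  have hb' := (hb μ).deriv_of_isOpen h.isOpen_time (m := ∞) (by simp)
  have sb := contDiffOn_time (U := U) (hb ν)
  have sb' := contDiffOn_time (U := U) hb'
  have D : ∀ {F : Coord → ℝ}, ContDiffOn ℝ ∞ F (region I U) → DifferentiableAt ℝ F p :=
    fun hF => differentiableAt_of_smooth hM hF hp
  have hI := h.isOpen_time.mem_nhds hp.1
  have e := pd_congr hM (fun q hq => E.deriv_mul_pd h hb hμν hq) hp 0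
  rw [pd_mul (D sb') (D sw), pd_const_mul ((D sb).fun_mul (D sv)), pd_mul (D sb) (D sv),
    pd_time ((hb'.contDiffAt hI).differentiableAt (by simp)),
    pd_time (((hb ν).contDiffAt hI).differentiableAt (by simp)), if_pos rfl, if_pos rfl,
    E.pd_zero_pd_time h _ hp] at e
  have e1 := E.pd_pd_time_space h hb μ μ ν hp
  have e2 := E.deriv_mul_pd h hb hμν hp
  linear_combination b ν (p 0) * e - deriv (b ν) (p 0) * e2 - 2 * b ν (p 0) * e1

/-- Time derivative of `pd_space_diag`. -/
lemma second_deriv_diag {μ ν : Fin 3} {p : Coord} (hp : p ∈ region I U) :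
    (deriv (deriv (b μ)) (p 0) * b μ (p 0) - deriv (b μ) (p 0) ^ 2) *
        pd ν.succ (fun q => Y q 0) p =
      -2 * pd μ.succ (pd μ.succ (pd ν.succ fun q => Y q 0)) p * b μ (p 0) := by
  have hM := h.isOpen_region
  have sw := contDiffOn_pd hM (E.smooth 0) ν.succ
  have sv := contDiffOn_pd hM (contDiffOn_pd hM (E.smooth μ.succ) μ.succ) ν.succ
  have hb' := (hb μ).deriv_of_isOpen h.isOpen_time (m := ∞) (by simp)
  have sb := contDiffOn_time (U := U) (hb μ)
  have sb' := contDiffOn_time (U := U) hb'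
  have D : ∀ {F : Coord → ℝ}, ContDiffOn ℝ ∞ F (region I U) → DifferentiableAt ℝ F p :=
    fun hF => differentiableAt_of_smooth hM hF hp
  have hI := h.isOpen_time.mem_nhds hp.1
  have e := pd_congr hM (fun q hq => E.pd_space_diag h hb (μ := μ) (ν := ν) hq) hp 0
  rw [pd_add ((D sb').fun_mul (D sw)) (((D sb).fun_mul (D sv)).const_mul 2), pd_mul (D sb') (D sw),
    pd_const_mul ((D sb).fun_mul (D sv)), pd_mul (D sb) (D sv),
    pd_time ((hb'.contDiffAt hI).differentiableAt (by simp)),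
    pd_time (((hb μ).contDiffAt hI).differentiableAt (by simp)), if_pos rfl, if_pos rfl,
    E.pd_zero_pd_time h _ hp, pd_const] at e
  have e1 := E.pd_pd_time_space h hb ν μ μ hp
  rw [E.pd_rotate h μ ν hp] at e1
  have e2 := E.pd_space_diag h hb (μ := μ) (ν := ν) hp
  linear_combination b μ (p 0) * e - deriv (b μ) (p 0) * e2 + 2 * b μ (p 0) * e1

/-- Time derivative of `space_diag`. -/
lemma second_deriv_time (μ : Fin 3) {p : Coord} (hp : p ∈ region I U) :
    (φ * deriv (b μ) (p 0) + 2 * pd μ.succ (pd μ.succ fun q => Y q 0) p) * b μ (p 0) +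
      Y p 0 * (deriv (deriv (b μ)) (p 0) * b μ (p 0) - deriv (b μ) (p 0) ^ 2) = 0 := by
  have hM := h.isOpen_region
  have sv := contDiffOn_pd hM (E.smooth μ.succ) μ.succ
  have hb' := (hb μ).deriv_of_isOpen h.isOpen_time (m := ∞) (by simp)
  have sb := contDiffOn_time (U := U) (hb μ)
  have sb' := contDiffOn_time (U := U) hb'
  have D : ∀ {F : Coord → ℝ}, ContDiffOn ℝ ∞ F (region I U) → DifferentiableAt ℝ F p :=
    fun hF => differentiableAt_of_smooth hM hF hp
  have hI := h.isOpen_time.mem_nhds hp.1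
  have d1 : DifferentiableAt ℝ (b μ) (p 0) := ((hb μ).contDiffAt hI).differentiableAt (by simp)
  have e := pd_congr hM (fun q hq => E.space_diag q hq μ) hp 0
  rw [pd_add ((D (E.smooth 0)).fun_mul (D sb')) (((D sb).fun_mul (D sv)).const_mul 2),
    pd_mul (D (E.smooth 0)) (D sb'), pd_const_mul ((D sb).fun_mul (D sv)), pd_mul (D sb) (D sv),
    pd_time ((hb'.contDiffAt hI).differentiableAt (by simp)), pd_const_mul (D sb), pd_time d1,
    if_pos rfl, if_pos rfl, E.time_time p hp] at e
  have e1 := E.pd_time_space h hb μ μ hp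
  have e2 := E.space_diag p hp μ
  linear_combination b μ (p 0) * e - deriv (b μ) (p 0) * e2 + 2 * b μ (p 0) * e1

/-- The second derivative of a metric function in terms of `∂_ν Y⁰`, for a nonzero homothetic
factor. -/
lemma second_deriv_mul_pd (hφ : φ ≠ 0) (hpos : ∀ μ, ∀ t ∈ I, 0 < b μ t) {μ ν : Fin 3}
    {p : Coord} (hp : p ∈ region I U) :
    deriv (deriv (b μ)) (p 0) * pd ν.succ (fun q => Y q 0) p =
      2 * pd μ.succ (pd μ.succ (pd ν.succ fun q => Y q 0)) p := by
  have hM := h.isOpen_region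
  -- Eliminate `b_μ'' b_μ - b_μ'²` between `second_deriv_time` and `second_deriv_diag`, then cancel
  -- `b_μ`. In the resulting identity only `b_μ'` and `Y⁰` vary with time, so its time derivative is
  -- `φ` times the claim.
  have e : ∀ q ∈ region I U,
      (φ * deriv (b μ) (q 0) + 2 * pd μ.succ (pd μ.succ fun q => Y q 0) q) *
        pd ν.succ (fun q => Y q 0) q =
      2 * (pd μ.succ (pd μ.succ (pd ν.succ fun q => Y q 0)) q * Y q 0) := by
    intro q hq
    refine mul_right_cancel₀ (hpos μ _ hq.1).ne' ?_
    linear_combination pd ν.succ (fun q => Y q 0) q * E.second_deriv_time h hb μ hq -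
      Y q 0 * E.second_deriv_diag h hb (μ := μ) (ν := ν) hq
  have sw := contDiffOn_pd hM (E.smooth 0) ν.succ
  have sq := contDiffOn_pd hM (contDiffOn_pd hM (E.smooth 0) μ.succ) μ.succ
  have sT := contDiffOn_pd hM (contDiffOn_pd hM sw μ.succ) μ.succ
  have hb' := (hb μ).deriv_of_isOpen h.isOpen_time (m := ∞) (by simp)
  have sb' := contDiffOn_time (U := U) hb'
  have D : ∀ {F : Coord → ℝ}, ContDiffOn ℝ ∞ F (region I U) → DifferentiableAt ℝ F p :=
    fun hF => differentiableAt_of_smooth hM hF hp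
  have hI := h.isOpen_time.mem_nhds hp.1
  have e0 := pd_congr hM e hp 0
  have c2 : ∀ c d : Fin 4, pd 0 (pd c (pd d fun q => Y q 0)) p = 0 := by
    intro c d
    rw [pd_comm hM (contDiffOn_pd hM (E.smooth 0) _) hp,
      pd_congr hM (fun q hq => E.pd_zero_pd_time h d hq) hp, pd_const]
  have c3 : pd 0 (pd μ.succ (pd μ.succ (pd ν.succ fun q => Y q 0))) p = 0 := by
    rw [pd_comm hM (contDiffOn_pd hM sw _) hp, pd_congr hM (G := fun _ => 0) (fun q hq => ?_) hp,
      pd_const]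
    rw [pd_comm hM sw hq, pd_congr hM (fun q hq => E.pd_zero_pd_time h ν.succ hq) hq, pd_const]
  rw [pd_mul (((D sb').const_mul φ).fun_add ((D sq).const_mul 2)) (D sw),
    pd_add ((D sb').const_mul φ) ((D sq).const_mul 2), pd_const_mul (D sb'),
    pd_const_mul (D sq), pd_const_mul ((D sT).fun_mul (D (E.smooth 0))),
    pd_mul (D sT) (D (E.smooth 0)), c3, c2,
    pd_time ((hb'.contDiffAt hI).differentiableAt (by simp)), if_pos rfl,
    E.pd_zero_pd_time h _ hp, E.time_time p hp] at e0
  refine mul_left_cancel₀ hφ ?_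
  linear_combination e0

/-- If `Y⁰` depends on `x^ν`, then the metric function `b_ν` is constant. -/
lemma deriv_eq_zero_of_pd_ne_zero (hφ : φ ≠ 0) (hpos : ∀ μ, ∀ t ∈ I, 0 < b μ t)
    (hne : ∀ μ ν, μ ≠ ν → ∀ C, ¬ ∀ t ∈ I, b μ t = C * b ν t) {ν : Fin 3}
    {p : Coord} (hp : p ∈ region I U) (hw : pd ν.succ (fun q => Y q 0) p ≠ 0)
    {t : ℝ} (ht : t ∈ I) : deriv (b ν) t = 0 := by
  by_contra hν
  have hM := h.isOpen_region
  have sw := contDiffOn_pd hM (E.smooth 0) ν.succ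
  have cross : ∀ μ, μ ≠ ν → ∀ q ∈ region I U,
      deriv (b μ) (q 0) * deriv (b ν) (q 0) * pd ν.succ (fun q => Y q 0) q = 0 := fun μ hμ q hq => by
    linear_combination b ν (q 0) * E.second_deriv_mul_pd h hb hφ hpos (μ := μ) (ν := ν) hq -
      E.second_deriv_cross h hb hμ hq
  have diag : ∀ μ, ∀ q ∈ region I U,
      deriv (b μ) (q 0) ^ 2 * pd ν.succ (fun q => Y q 0) q =
        4 * pd μ.succ (pd μ.succ (pd ν.succ fun q => Y q 0)) q * b μ (q 0) := fun μ q hq => by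
    linear_combination b μ (q 0) * E.second_deriv_mul_pd h hb hφ hpos (μ := μ) (ν := ν) hq -
      E.second_deriv_diag h hb (μ := μ) (ν := ν) hq
  set x : Fin 3 → ℝ := fun μ => p μ.succ with hx
  have hpx : (Fin.cons (p 0) x : Coord) = p := Fin.cons_self_tail p
  have hxU : x ∈ U := hp.2
  have hwt : ∀ s ∈ I, pd ν.succ (fun q => Y q 0) (Fin.cons s x) ≠ 0 := fun s hs => by
    rw [h.eq_cons_of_pd_zero sw (fun q hq => E.pd_zero_pd_time h _ hq) hxU hs hp.1, hpx]
    exact hw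
  have hzero : ∀ μ, μ ≠ ν → ∀ s ∈ I, deriv (b μ) s = 0 := by
    intro μ hμ s hs
    -- At the time `t`, where `b_ν' ≠ 0`, `cross` gives `b_μ' = 0` and then `diag` gives `T_μ = 0`.
    -- Since `T_μ` is independent of time, it vanishes over `x` at all times, and `diag` yields
    -- `b_μ' = 0` on `I`.
    have hμt : deriv (b μ) t = 0 := by
      have := cross μ hμ _ (cons_mem_region ht hxU)
      simpa [hν, hwt t ht] using this
    have hT : pd μ.succ (pd μ.succ (pd ν.succ fun q => Y q 0)) (Fin.cons t x) = 0 := by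
      have := diag μ _ (cons_mem_region ht hxU)
      simpa [hμt, (hpos μ t ht).ne'] using this
    have hT0 : ∀ q ∈ region I U,
        pd 0 (pd μ.succ (pd μ.succ (pd ν.succ fun q => Y q 0))) q = 0 := by
      intro q hq
      rw [pd_comm hM (contDiffOn_pd hM sw _) hq, pd_congr hM (G := fun _ => 0) (fun q hq => ?_) hq,
        pd_const]
      rw [pd_comm hM sw hq, pd_congr hM (fun q hq => E.pd_zero_pd_time h ν.succ hq) hq, pd_const]
    have hs' := diag μ _ (cons_mem_region hs hxU)
    rw [h.eq_cons_of_pd_zero (contDiffOn_pd hM (contDiffOn_pd hM sw _) _) hT0 hxU hs ht, hT] at hs'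
    simpa [hwt s hs] using hs'
  -- The two indices other than `ν` have constant, hence proportional, metric functions.
  obtain ⟨μ, κ, hμ, hκ, hμκ⟩ : ∃ μ κ : Fin 3, μ ≠ ν ∧ κ ≠ ν ∧ μ ≠ κ :=
    (by decide : ∀ ν : Fin 3, ∃ μ κ : Fin 3, μ ≠ ν ∧ κ ≠ ν ∧ μ ≠ κ) ν
  have hconst : ∀ μ, μ ≠ ν → ∀ s ∈ I, b μ s = b μ t := fun μ hμ s hs =>
    h.isOpen_time.is_const_of_deriv_eq_zero h.isConnected_time.isPreconnected
      ((hb μ).differentiableOn (by simp)) (hzero μ hμ) hs ht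
  refine hne μ κ hμκ (b μ t / b κ t) fun s hs => ?_
  rw [hconst μ hμ s hs, hconst κ hκ s hs, div_mul_cancel₀ _ (hpos κ t ht).ne']

/-- The time component of a proper homothetic vector field depends on time only. -/
lemma pd_time_eq_zero (hφ : φ ≠ 0) (hpos : ∀ μ, ∀ t ∈ I, 0 < b μ t)
    (hne : ∀ μ ν, μ ≠ ν → ∀ C, ¬ ∀ t ∈ I, b μ t = C * b ν t) (ν : Fin 3)
    {p : Coord} (hp : p ∈ region I U) : pd ν.succ (fun q => Y q 0) p = 0 := by
  by_contra hw
  have hM := h.isOpen_region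
  have hconst : ∀ μ, (∀ s ∈ I, deriv (b μ) s = 0) → ∀ s ∈ I, b μ s = b μ (p 0) :=
    fun μ hμ s hs => h.isOpen_time.is_const_of_deriv_eq_zero h.isConnected_time.isPreconnected
      ((hb μ).differentiableOn (by simp)) hμ hs hp.1
  have hν := hconst ν fun t ht => E.deriv_eq_zero_of_pd_ne_zero h hb hφ hpos hne hp hw ht
  obtain ⟨μ, hμ⟩ : ∃ μ : Fin 3, μ ≠ ν := exists_ne ν
  have hμne : ¬ ∀ s ∈ I, deriv (b μ) s = 0 := fun h0 =>
    hne μ ν hμ (b μ (p 0) / b ν (p 0)) fun s hs => by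
      rw [hconst μ h0 s hs, hν s hs, div_mul_cancel₀ _ (hpos ν _ hp.1).ne']
  -- As `b_μ` is not constant, the preceding lemma applied to `μ` shows that `Y⁰` does not depend on
  -- `x^μ`. Hence `T_μ = ∂_ν ∂_μ² Y⁰ = 0`, which gives first `b_μ'' = 0` and then `b_μ'² = 0`.
  have hμ0 : ∀ q ∈ region I U, pd μ.succ (fun q => Y q 0) q = 0 := fun q hq => by
    by_contra hq0
    exact hμne fun s hs => E.deriv_eq_zero_of_pd_ne_zero h hb hφ hpos hne hq hq0 hs
  set x : Fin 3 → ℝ := fun μ => p μ.succ with hx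
  have hpx : (Fin.cons (p 0) x : Coord) = p := Fin.cons_self_tail p
  have hxU : x ∈ U := hp.2
  refine hμne fun s hs => ?_
  have hq := cons_mem_region hs hxU
  have e1 := E.second_deriv_mul_pd h hb hφ hpos (μ := μ) (ν := ν) hq
  have e2 := E.second_deriv_diag h hb (μ := μ) (ν := ν) hq
  have hT : pd μ.succ (pd μ.succ (pd ν.succ fun q => Y q 0)) (Fin.cons s x) = 0 := by
    rw [← E.pd_rotate h μ ν hq, pd_congr hM (G := fun _ => 0) (fun q hq => ?_) hq, pd_const]
    rw [pd_congr hM hμ0 hq, pd_const]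
  have hws : pd ν.succ (fun q => Y q 0) (Fin.cons s x) ≠ 0 := by
    rw [h.eq_cons_of_pd_zero (contDiffOn_pd hM (E.smooth 0) _)
      (fun q hq => E.pd_zero_pd_time h _ hq) hxU hs hp.1, hpx]
    exact hw
  rw [hT] at e1 e2
  have e3 : deriv (deriv (b μ)) s = 0 := by simpa [hws] using e1
  simpa [hws, e3] using e2

omit hb in
/-- A homothetic vector field whose time component depends on time only is affine. -/
lemma exists_affine (hpos : ∀ μ, ∀ t ∈ I, 0 < b μ t)
    (hne : ∀ μ ν, μ ≠ ν → ∀ C, ¬ ∀ t ∈ I, b μ t = C * b ν t)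
    (h0 : ∀ ν : Fin 3, ∀ p ∈ region I U, pd ν.succ (fun q => Y q 0) p = 0) :
    ∃ (r : ℝ) (a s : Fin 3 → ℝ),
      (∀ p ∈ region I U, Y p 0 = φ * p 0 + r ∧ ∀ μ : Fin 3, Y p μ.succ = a μ * p μ.succ + s μ) ∧
      ∀ μ, ∀ t ∈ I, (φ * t + r) * deriv (b μ) t = 2 * (φ - a μ) * b μ t := by
  have hM := h.isOpen_region
  obtain ⟨t₁, ht₁⟩ := h.isConnected_time.nonempty
  obtain ⟨x₁, hx₁⟩ := h.isConnected_space.nonempty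
  have hp₁ := cons_mem_region ht₁ hx₁
  set p₁ : Coord := Fin.cons t₁ x₁ with hp₁def
  have scoord : ∀ c, ContDiffOn ℝ ∞ (fun q : Coord => q c) (region I U) := fun c =>
    (contDiff_apply ℝ ℝ c).contDiffOn
  -- a component with constant partial derivatives is affine
  have affine : ∀ (c d : Fin 4) (r : ℝ), (∀ p ∈ region I U, ∀ e,
      pd e (fun q => Y q c) p = if d = e then r else 0) →
      ∀ p ∈ region I U, Y p c = r * p d + (Y p₁ c - r * p₁ d) := by
    intro c d r hc p hp
    have := h.eq_of_pd_eq_zero (F := fun q => Y q c + (-r) * q d)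
      ((E.smooth c).add (contDiffOn_const.mul (scoord d))) (fun p hp e => ?_) hp hp₁
    · linear_combination this
    · rw [pd_add (differentiableAt_of_smooth hM (E.smooth c) hp)
        ((differentiableAt_of_smooth hM (scoord d) hp).const_mul _),
        pd_const_mul (differentiableAt_of_smooth hM (scoord d) hp), hc p hp, pd_coord]
      split_ifs <;> ring
  have hY0 := affine 0 0 φ fun p hp e => by
    refine Fin.cases ?_ (fun ν => ?_) e
    · simpa using E.time_time p hp
    · simpa [(Fin.succ_ne_zero ν).symm] using h0 ν p hp
  have hvt : ∀ μ : Fin 3, ∀ p ∈ region I U, pd 0 (fun q => Y q μ.succ) p = 0 := fun μ p hp => by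
    have := E.time_space p hp μ
    rw [h0 μ p hp] at this
    simpa [(hpos μ _ hp.1).ne'] using this.symm
  have hvt' : ∀ (μ : Fin 3) (c : Fin 4), ∀ p ∈ region I U,
      pd 0 (pd c fun q => Y q μ.succ) p = 0 := fun μ c p hp => by
    rw [pd_comm hM (E.smooth _) hp, pd_congr hM (hvt μ) hp, pd_const]
  have hoff : ∀ μ ν : Fin 3, μ ≠ ν → ∀ p ∈ region I U, pd ν.succ (fun q => Y q μ.succ) p = 0 := by
    intro μ ν hμν p hp
    by_contra hk
    set x : Fin 3 → ℝ := fun μ => p μ.succ with hx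
    have hpx : (Fin.cons (p 0) x : Coord) = p := Fin.cons_self_tail p
    have hxU : x ∈ U := hp.2
    -- Over `x`, `space_space` is a linear relation between `b_μ` and `b_ν` with time-independent
    -- coefficients; their ratio is the constant of proportionality.
    refine hne μ ν hμν (-pd μ.succ (fun q => Y q ν.succ) p / pd ν.succ (fun q => Y q μ.succ) p)
      fun t ht => ?_
    have e := E.space_space _ (cons_mem_region ht hxU) μ ν hμν
    rw [h.eq_cons_of_pd_zero (contDiffOn_pd hM (E.smooth _) _) (hvt' μ ν.succ) hxU ht hp.1,
      h.eq_cons_of_pd_zero (contDiffOn_pd hM (E.smooth _) _) (hvt' ν μ.succ) hxU ht hp.1, hpx,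
      Fin.cons_zero] at e
    field_simp
    linear_combination e
  -- `∂_μ Y^μ` does not change with time, so it may be evaluated at `t₁`; there `space_diag`
  -- determines it by quantities that do not depend on the spatial point.
  have hdiag : ∀ μ : Fin 3, ∀ p ∈ region I U, pd μ.succ (fun q => Y q μ.succ) p =
      pd μ.succ (fun q => Y q μ.succ) p₁ := by
    intro μ p hp
    have hpx : (Fin.cons (p 0) (fun μ => p μ.succ) : Coord) = p := Fin.cons_self_tail p
    have hq := cons_mem_region ht₁ hp.2
    have e0 := E.space_diag _ hq μ
    have e1 := E.space_diag _ hp₁ μ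
    rw [hY0 _ hq] at e0
    rw [hY0 _ hp₁] at e1
    have e2 := h.eq_cons_of_pd_zero (contDiffOn_pd hM (E.smooth μ.succ) μ.succ)
      (hvt' μ μ.succ) hp.2 hp.1 ht₁
    rw [hpx] at e2
    rw [e2]
    simp only [hp₁def, Fin.cons_zero] at e0 e1 ⊢
    refine mul_left_cancel₀ (hpos μ _ ht₁).ne' ?_
    linarith
  refine ⟨Y p₁ 0 - φ * p₁ 0, fun μ => pd μ.succ (fun q => Y q μ.succ) p₁,
    fun μ => Y p₁ μ.succ - pd μ.succ (fun q => Y q μ.succ) p₁ * p₁ μ.succ,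
    fun p hp => ⟨hY0 p hp, fun μ => affine μ.succ μ.succ _ (fun p hp e => ?_) p hp⟩, ?_⟩
  · refine Fin.cases ?_ (fun ν => ?_) e
    · simpa using hvt μ p hp
    · by_cases hμν : μ = ν
      · subst hμν
        simpa using hdiag μ p hp
      · simpa [hμν] using hoff μ ν hμν p hp
  · intro μ t ht
    have hq := cons_mem_region ht hx₁
    have e := E.space_diag _ hq μ
    rw [hY0 _ hq, hdiag μ _ hq] at e
    simp only [Fin.cons_zero] at e
    linear_combination e

end HomotheticEqs

end Rigidity

/-! ### Kasner-type metrics -/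

section Kasner

variable {I : Set ℝ} {U : Set (Fin 3 → ℝ)}

lemma pd_const_mul_coord (r : ℝ) (c d : Fin 4) (p : Coord) :
    pd c (fun q => r * q d) p = if d = c then r else 0 := by
  rw [pd_const_mul (by fun_prop), pd_coord]
  split_ifs <;> simp

/-- If two metric functions were proportional, a rotation would be a Killing vector field. -/
lemma not_proportional_of_killing_tangent (h : IsAdmissible I U) {b : Fin 3 → ℝ → ℝ}
    (hb : ∀ μ, ContDiffOn ℝ ∞ (b μ) I)
    (hK : ∀ X : VField, IsKilling (region I U) (warpedMetric b) X →
      (∀ p ∈ region I U, X p 0 = 0) →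
      ∃ s : Fin 3 → ℝ, ∀ p ∈ region I U, X p = translation s)
    (μ ν : Fin 3) (hμν : μ ≠ ν) (C : ℝ) : ¬ ∀ t ∈ I, b μ t = C * b ν t := by
  intro hC
  have hM := h.isOpen_region
  -- The rotation `x^ν ∂_μ - C x^μ ∂_ν`. Its `μ`-component has `∂_ν`-derivative `1`, so it is not a
  -- translation.
  let X : VField := fun p => Fin.cons 0 fun κ =>
    (if κ = μ then 1 else 0) * p ν.succ + (if κ = ν then -C else 0) * p μ.succ
  have hX : ∀ (κ : Fin 3) (c : Fin 4) (p : Coord), pd c (fun q => X q κ.succ) p =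
      (if ν.succ = c then (if κ = μ then 1 else 0) else 0) +
        (if μ.succ = c then (if κ = ν then -C else 0) else 0) := by
    intro κ c p
    simp only [X, Fin.cons_succ]
    rw [pd_add (by fun_prop) (by fun_prop), pd_const_mul_coord, pd_const_mul_coord]
  have hE : HomotheticEqs (region I U) b X 0 := by
    refine ⟨fun c => ?_, fun p hp => ?_, fun p hp κ => ?_, fun p hp κ l hκl => ?_, fun p hp κ => ?_⟩
    · refine Fin.cases ?_ (fun κ => ?_) c
      · simp only [X, Fin.cons_zero]
        exact contDiffOn_const
      · simp only [X, Fin.cons_succ]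
        exact ContDiff.contDiffOn (by fun_prop)
    · simp [X]
    · rw [hX]
      simp [X]
    · rw [hX, hX]
      have := hC _ hp.1
      simp only [Fin.succ_inj]
      split_ifs <;> subst_vars <;> simp_all <;> ring
    · rw [hX]
      simp only [X, Fin.cons_zero, Fin.succ_inj]
      split_ifs <;> subst_vars <;> simp_all
  have hd : ∀ p ∈ region I U, ∀ μ, DifferentiableAt ℝ (b μ) (p 0) := fun p hp μ =>
    ((hb μ).contDiffAt (h.isOpen_time.mem_nhds hp.1)).differentiableAt (by simp)
  obtain ⟨s, hs⟩ := hK X ((isHVF_warpedMetric_iff hd).2 hE) fun p _ => by simp [X]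
  obtain ⟨t₁, ht₁⟩ := h.isConnected_time.nonempty
  obtain ⟨x₁, hx₁⟩ := h.isConnected_space.nonempty
  have e := pd_congr hM (F := fun q => X q μ.succ) (G := fun _ => s μ)
    (fun q hq => by simp [hs q hq, translation]) (cons_mem_region ht₁ hx₁) ν.succ
  rw [hX, pd_const] at e
  simp [hμν] at e

/-- The factor `ε² = 1` preserves `-dt²`, while rescaling `x^μ` contributes `k_μ²`. -/
lemma pullback_kasnerMetric (φ ε t₀ : ℝ) (a k : Fin 3 → ℝ) (hε : ε * ε = 1) (p : Coord) :
    pullback (coordChange ε t₀ k) (kasnerMetric φ a) p =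
      Matrix.diagonal (Fin.cons (-1) fun μ =>
        k μ ^ 2 * (ε * (p 0 - t₀)) ^ (2 * ((φ - a μ) / φ))) := by
  have hpd : ∀ c d : Fin 4, pd c (fun q => coordChange ε t₀ k q d) p =
      if d = c then (Fin.cons ε k : Coord) d else 0 := by
    intro c d
    refine Fin.cases ?_ (fun μ => ?_) d
    · have : (fun q => coordChange ε t₀ k q 0) = fun q => ε * q 0 + (-(ε * t₀)) := by
        ext q
        simp [coordChange]
        ring
      rw [this, pd_add (by fun_prop) (by fun_prop), pd_const_mul_coord, pd_const]
      simp
    · simp only [coordChange, Fin.cons_succ]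
      rw [pd_const_mul_coord]
  ext i j
  simp only [pullback, Matrix.of_apply, hpd]
  by_cases hij : i = j
  · subst hij
    refine Fin.cases ?_ (fun μ => ?_) i
    · simp [kasnerMetric, hε, Matrix.diagonal_apply, mul_assoc]
    · simp [kasnerMetric, coordChange, Matrix.diagonal_apply]
      ring
  · simp [kasnerMetric, Matrix.diagonal_apply, hij]

lemma fderiv_coordChange (ε t₀ : ℝ) (k : Fin 3 → ℝ) (p v : Coord) :
    fderiv ℝ (coordChange ε t₀ k) p v = Fin.cons (ε * v 0) fun μ => k μ * v μ.succ := by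
  have hd : ∀ c, DifferentiableAt ℝ (fun q => coordChange ε t₀ k q c) p := by
    refine Fin.cases ?_ fun μ => ?_
    · simp only [coordChange, Fin.cons_zero]
      fun_prop
    · simp only [coordChange, Fin.cons_succ]
      fun_prop
  ext c
  rw [fderiv_pi hd]
  simp only [ContinuousLinearMap.coe_pi']
  refine Fin.cases ?_ (fun μ => ?_) c
  · simp only [coordChange, Fin.cons_zero]
    rw [fderiv_const_mul (by fun_prop), fderiv_sub_const, (hasFDerivAt_apply _ p).fderiv]
    simp
  · simp only [coordChange, Fin.cons_succ]
    rw [fderiv_const_mul (by fun_prop), (hasFDerivAt_apply _ p).fderiv]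
    simp

/-- Two metric functions solving the same equation `(φ t + r) b' = m b` are proportional. -/
lemma exists_proportional (hI : IsOpen I) (hc : IsConnected I) {φ r m : ℝ} (hφ : φ ≠ 0)
    {b c : ℝ → ℝ} (hb : ContDiffOn ℝ ∞ b I) (hc' : ContDiffOn ℝ ∞ c I) (hpos : ∀ t ∈ I, 0 < c t)
    (eb : ∀ t ∈ I, (φ * t + r) * deriv b t = m * b t)
    (ec : ∀ t ∈ I, (φ * t + r) * deriv c t = m * c t) : ∃ C, ∀ t ∈ I, b t = C * c t := by
  have db : ∀ {f : ℝ → ℝ}, ContDiffOn ℝ ∞ f I → ∀ t ∈ I, DifferentiableAt ℝ f t :=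
    fun hf t ht => (hf.contDiffAt (hI.mem_nhds ht)).differentiableAt (by simp)
  have hW : ∀ t ∈ I, (φ * t + r) * (deriv b t * c t - b t * deriv c t) = 0 := fun t ht => by
    linear_combination c t * eb t ht - b t * ec t ht
  have hW0 : ∀ t ∈ I, deriv b t * c t - b t * deriv c t = 0 := by
    intro t ht
    -- At a zero of `φ t + r`, differentiating `(φ t + r) W = 0` gives `φ W = 0`. Such a zero must
    -- be allowed: it is excluded from `I` only afterwards, by the distinctness of the `a_μ` that
    -- this lemma provides.
    by_cases h0 : φ * t + r = 0
    · have hd : DifferentiableAt ℝ (fun t => deriv b t * c t - b t * deriv c t) t :=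
        ((db (hb.deriv_of_isOpen hI (m := ∞) (by simp)) t ht).fun_mul (db hc' t ht)).fun_sub
          ((db hb t ht).fun_mul (db (hc'.deriv_of_isOpen hI (m := ∞) (by simp)) t ht))
      have h1 := (((hasDerivAt_id' t).const_mul φ).add_const r).fun_mul hd.hasDerivAt
      have h2 : HasDerivAt (fun t => (φ * t + r) * (deriv b t * c t - b t * deriv c t)) 0 t :=
        (hasDerivAt_const t (0 : ℝ)).congr_of_eventuallyEq
          (Filter.eventuallyEq_of_mem (hI.mem_nhds ht) hW)
      have := h1.unique h2
      rw [h0] at this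
      simpa [hφ] using this
    · simpa [h0] using hW t ht
  obtain ⟨t₁, ht₁⟩ := hc.nonempty
  refine ⟨b t₁ / c t₁, fun t ht => ?_⟩
  have hd : ∀ t ∈ I, HasDerivAt (fun t => b t / c t) 0 t := fun t ht => by
    have := (db hb t ht).hasDerivAt.fun_div (db hc' t ht).hasDerivAt (hpos t ht).ne'
    rwa [hW0 t ht, zero_div] at this
  have := hI.is_const_of_deriv_eq_zero hc.isPreconnected
    (fun t ht => (hd t ht).differentiableAt.differentiableWithinAt)
    (fun t ht => (hd t ht).deriv) ht ht₁
  rw [← this, div_mul_cancel₀ _ (hpos t ht).ne']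

/-- Solutions of `(t - t₀) b' = m b` are multiples of powers. -/
lemma exists_eq_rpow (hI : IsOpen I) (hc : IsConnected I) {ε t₀ m : ℝ}
    (hτ : ∀ t ∈ I, 0 < ε * (t - t₀)) {b : ℝ → ℝ} (hb : ContDiffOn ℝ ∞ b I)
    (hpos : ∀ t ∈ I, 0 < b t) (eb : ∀ t ∈ I, (t - t₀) * deriv b t = m * b t) :
    ∃ k, 0 < k ∧ ∀ t ∈ I, b t = k ^ 2 * (ε * (t - t₀)) ^ m := by
  have hd : ∀ t ∈ I, HasDerivAt (fun t => b t * (ε * (t - t₀)) ^ (-m)) 0 t := fun t ht => by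
    have h1 := ((hb.contDiffAt (hI.mem_nhds ht)).differentiableAt (by simp)).hasDerivAt
    have h2 := (((hasDerivAt_id' t).sub_const t₀).const_mul ε).rpow_const (p := -m)
      (Or.inl (hτ t ht).ne')
    refine (h1.fun_mul h2).congr_deriv ?_
    have h3 : (ε * (t - t₀)) ^ (-m) = (ε * (t - t₀)) ^ (-m - 1) * (ε * (t - t₀)) := by
      rw [Real.rpow_sub_one (hτ t ht).ne', div_mul_cancel₀ _ (hτ t ht).ne']
    rw [h3]
    linear_combination (ε * (ε * (t - t₀)) ^ (-m - 1)) * eb t ht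
  obtain ⟨t₁, ht₁⟩ := hc.nonempty
  have hC : 0 < b t₁ * (ε * (t₁ - t₀)) ^ (-m) :=
    mul_pos (hpos _ ht₁) (Real.rpow_pos_of_pos (hτ _ ht₁) _)
  -- The product `b (ε (t - t₀))^(-m)` is constant; its square root is the coordinate scale `k`,
  -- since the metric sees `k²`.
  refine ⟨√(b t₁ * (ε * (t₁ - t₀)) ^ (-m)), Real.sqrt_pos.2 hC, fun t ht => ?_⟩
  have := hI.is_const_of_deriv_eq_zero hc.isPreconnected
    (fun t ht => (hd t ht).differentiableAt.differentiableWithinAt)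
    (fun t ht => (hd t ht).deriv) ht ht₁
  rw [Real.sq_sqrt hC.le, ← this, mul_assoc, ← Real.rpow_add (hτ t ht), neg_add_cancel,
    Real.rpow_zero, mul_one]

lemma exists_kasner_of_isProperHVF {g : MetricField} (hg : IsProperDiagonal I U g)
    {Y : VField} {φ : ℝ} (hY : IsProperHVF (region I U) g Y φ) :
    ∃ a : Fin 3 → ℝ, Function.Injective a ∧
      ∃ (ε t₀ : ℝ) (k s : Fin 3 → ℝ), (ε = 1 ∨ ε = -1) ∧ (∀ μ, 0 < k μ) ∧
        ∀ p ∈ region I U,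
          0 < coordChange ε t₀ k p 0 ∧
          g p = pullback (coordChange ε t₀ k) (kasnerMetric φ a) p ∧
          fderiv ℝ (coordChange ε t₀ k) p (Y p) =
            kasnerHVF φ a (coordChange ε t₀ k p) + translation s := by
  obtain ⟨h, ⟨A, hA, hA0, -, hgA⟩, hK⟩ := hg
  obtain ⟨hY, hφ⟩ := hY
  have hM := h.isOpen_region
  set b : Fin 3 → ℝ → ℝ := fun μ t => A μ t ^ 2 with hbdef
  have hgb : ∀ p ∈ region I U, g p = warpedMetric b p := hgA
  have hb : ∀ μ, ContDiffOn ℝ ∞ (b μ) I := fun μ => (hA μ).pow 2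
  have hpos : ∀ μ, ∀ t ∈ I, 0 < b μ t := fun μ t ht => by have := hA0 μ t ht; positivity
  have hne := not_proportional_of_killing_tangent h hb fun X hX =>
    hK X ((isHVF_congr hM hgb).2 hX)
  have hd : ∀ p ∈ region I U, ∀ μ, DifferentiableAt ℝ (b μ) (p 0) := fun p hp μ =>
    ((hb μ).contDiffAt (h.isOpen_time.mem_nhds hp.1)).differentiableAt (by simp)
  have E := (isHVF_warpedMetric_iff hd).1 ((isHVF_congr hM hgb).1 hY)
  obtain ⟨r, a, s, haff, hode⟩ := E.exists_affine h hpos hne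
    fun ν p hp => E.pd_time_eq_zero h hb hφ hpos hne ν hp
  have hinj : Function.Injective a := by
    intro μ ν hμν
    by_contra hne'
    obtain ⟨C, hC⟩ := exists_proportional h.isOpen_time h.isConnected_time hφ (hb μ) (hb ν)
      (hpos ν) (hode μ) (hμν ▸ hode ν)
    exact hne μ ν hne' C hC
  set t₀ : ℝ := -r / φ with ht₀
  have hlin : ∀ t, φ * t + r = φ * (t - t₀) := fun t => by rw [ht₀]; field_simp; ring
  -- At `t₀` the left side of the equation for `b_μ` vanishes, so every `a_μ` would equal `φ`.
  have ht₀I : t₀ ∉ I := by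
    intro hmem
    have hφa : ∀ μ, a μ = φ := fun μ => by
      have := hode μ t₀ hmem
      rw [hlin, sub_self, mul_zero, zero_mul] at this
      have h2 := mul_eq_zero.1 this.symm
      have h3 : φ - a μ = 0 := by simpa [(hpos μ t₀ hmem).ne'] using h2
      linarith
    exact absurd (hinj ((hφa 0).trans (hφa 1).symm)) (by decide)
  -- An interval that misses `t₀` lies on one side of it; `ε` records which.
  obtain ⟨ε, hε, hτ⟩ : ∃ ε : ℝ, (ε = 1 ∨ ε = -1) ∧ ∀ t ∈ I, 0 < ε * (t - t₀) := by
    have hord := h.isConnected_time.isPreconnected.ordConnected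
    by_cases hex : ∃ t₁ ∈ I, t₀ < t₁
    · obtain ⟨t₁, ht₁, hlt⟩ := hex
      refine ⟨1, Or.inl rfl, fun t ht => ?_⟩
      by_contra hcon
      exact ht₀I (hord.out ht ht₁ ⟨by linarith, hlt.le⟩)
    · push Not at hex
      refine ⟨-1, Or.inr rfl, fun t ht => ?_⟩
      have := lt_of_le_of_ne (hex t ht) fun he => ht₀I (he ▸ ht)
      linarith
  have hε2 : ε * ε = 1 := by rcases hε with rfl | rfl <;> norm_num
  have hsol : ∀ μ, ∃ k, 0 < k ∧ ∀ t ∈ I,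
      b μ t = k ^ 2 * (ε * (t - t₀)) ^ (2 * ((φ - a μ) / φ)) := fun μ =>
    exists_eq_rpow h.isOpen_time h.isConnected_time hτ (hb μ) (hpos μ) fun t ht => by
      have := hode μ t ht
      rw [hlin] at this
      field_simp
      linear_combination this
  choose k hk hkb using hsol
  -- In the rescaled coordinates the translation `s_μ ∂_μ` has components `k_μ s_μ`.
  refine ⟨a, hinj, ε, t₀, k, fun μ => k μ * s μ, hε, hk, fun p hp => ⟨?_, ?_, ?_⟩⟩
  · simpa [coordChange] using hτ _ hp.1
  · rw [pullback_kasnerMetric _ _ _ _ _ hε2, hgb p hp, warpedMetric]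
    congr 1
    congr 1
    funext μ
    exact hkb μ _ hp.1
  · rw [fderiv_coordChange]
    obtain ⟨hY0, hYμ⟩ := haff p hp
    funext c
    refine Fin.cases ?_ (fun μ => ?_) c
    · simp only [kasnerHVF, coordChange, translation, Pi.add_apply, Fin.cons_zero]
      rw [hY0, hlin]
      ring
    · simp only [kasnerHVF, coordChange, translation, Pi.add_apply, Fin.cons_succ]
      rw [hYμ]
      ring

/-! ### The converse -/

lemma contDiffOn_rpow_Ioi {m : ℝ} (hI : I ⊆ Set.Ioi 0) :
    ContDiffOn ℝ ∞ (fun t : ℝ => t ^ m) I := fun _ ht =>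
  (Real.contDiffAt_rpow_const_of_ne (ne_of_gt (hI ht))).contDiffWithinAt

/-- Otherwise `t^(m - n)` would be constant on `I`, but it is injective for `t > 0` and `I` has two
distinct points. -/
lemma rpow_not_proportional (hI : IsOpen I) (hne : I.Nonempty) (hI0 : I ⊆ Set.Ioi 0)
    {m n : ℝ} (hmn : m ≠ n) (C : ℝ) : ¬ ∀ t ∈ I, t ^ m = C * t ^ n := by
  intro hC
  obtain ⟨t₁, ht₁⟩ := hne
  obtain ⟨x, hx, y, hy, hxy⟩ := (infinite_of_mem_nhds t₁ (hI.mem_nhds ht₁)).nontrivial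
  have key : ∀ t ∈ I, t ^ (m - n) = C := fun t ht => by
    have h0 : 0 < t := hI0 ht
    rw [Real.rpow_sub h0, hC t ht, mul_div_cancel_right₀ _ (Real.rpow_pos_of_pos h0 n).ne']
  exact hxy (Real.rpow_left_injOn (sub_ne_zero.2 hmn) (Set.mem_Ioi.1 (hI0 hx)).le
    (Set.mem_Ioi.1 (hI0 hy)).le ((key x hx).trans (key y hy).symm))

lemma time_mul_deriv_rpow {t m : ℝ} (ht : 0 < t) :
    t * deriv (fun t : ℝ => t ^ m) t = m * t ^ m := by
  rw [Real.deriv_rpow_const, Real.rpow_sub_one ht.ne']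
  field_simp

variable {φ : ℝ} {a : Fin 3 → ℝ}

lemma kasner_exponent_injective (hφ : φ ≠ 0) (ha : Function.Injective a) :
    Function.Injective fun μ => 2 * ((φ - a μ) / φ) := by
  intro μ ν hμν
  refine ha ?_
  dsimp only at hμν
  field_simp at hμν
  linarith

lemma isHVF_kasnerMetric_iff (h : IsAdmissible I U) (hI0 : I ⊆ Set.Ioi 0) {Y : VField} {ψ : ℝ} :
    IsHVF (region I U) (kasnerMetric φ a) Y ψ ↔
      HomotheticEqs (region I U) (fun μ t => t ^ (2 * ((φ - a μ) / φ))) Y ψ :=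
  isHVF_warpedMetric_iff fun _ hp _ =>
    ((contDiffOn_rpow_Ioi hI0).contDiffAt (h.isOpen_time.mem_nhds hp.1)).differentiableAt (by simp)

lemma isProperDiagonal_kasnerMetric (hφ : φ ≠ 0) (ha : Function.Injective a)
    (h : IsAdmissible I U) (hI0 : I ⊆ Set.Ioi 0) :
    IsProperDiagonal I U (kasnerMetric φ a) := by
  have hne : ∀ μ ν : Fin 3, μ ≠ ν → ∀ C : ℝ,
      ¬ ∀ t ∈ I, t ^ (2 * ((φ - a μ) / φ)) = C * t ^ (2 * ((φ - a ν) / φ)) := fun μ ν hμν =>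
    rpow_not_proportional h.isOpen_time h.isConnected_time.nonempty hI0
      ((kasner_exponent_injective hφ ha).ne hμν)
  have hsq : ∀ t ∈ I, ∀ m : ℝ, t ^ (2 * m) = (t ^ m) ^ 2 := fun t ht m => by
    rw [mul_comm, Real.rpow_mul (le_of_lt (hI0 ht)), Real.rpow_two]
  refine ⟨h, ⟨fun μ t => t ^ ((φ - a μ) / φ), fun μ => contDiffOn_rpow_Ioi hI0,
    fun μ t ht => (Real.rpow_pos_of_pos (hI0 ht) _).ne', fun μ ν hμν heq => ?_,
    fun p hp => ?_⟩, fun X hX hX0 => ?_⟩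
  · refine hne μ ν hμν 1 fun t ht => ?_
    rw [hsq t ht, hsq t ht, one_mul]
    exact congrArg (· ^ 2) (heq ht)
  · simp only [kasnerMetric, diagMetric, hsq _ hp.1]
  · have hpos : ∀ (μ : Fin 3), ∀ t ∈ I, 0 < t ^ (2 * ((φ - a μ) / φ)) := fun μ t ht =>
      Real.rpow_pos_of_pos (hI0 ht) _
    -- The affine form also holds for homothetic factor `0`, as the time component vanishes by
    -- assumption. Then `r = 0`, and the equation for the metric functions forces all linear
    -- coefficients to vanish.
    have E := (isHVF_kasnerMetric_iff h hI0).1 hX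
    obtain ⟨r, c, s, haff, hode⟩ := E.exists_affine h hpos hne
      fun ν p hp => by rw [pd_congr h.isOpen_region hX0 hp, pd_const]
    obtain ⟨t₁, ht₁⟩ := h.isConnected_time.nonempty
    obtain ⟨x₁, hx₁⟩ := h.isConnected_space.nonempty
    have hr : r = 0 := by
      have h1 := (haff _ (cons_mem_region ht₁ hx₁)).1
      rw [hX0 _ (cons_mem_region ht₁ hx₁)] at h1
      linarith
    have hc : ∀ μ, c μ = 0 := fun μ => by
      have := hode μ t₁ ht₁
      rw [hr] at this
      simpa [(hpos μ t₁ ht₁).ne'] using this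
    refine ⟨s, fun p hp => funext fun d => ?_⟩
    refine Fin.cases ?_ (fun μ => ?_) d
    · simpa [translation] using hX0 p hp
    · simpa [translation, hc] using (haff p hp).2 μ

lemma isProperHVF_kasnerHVF (hφ : φ ≠ 0) (h : IsAdmissible I U) (hI0 : I ⊆ Set.Ioi 0) :
    IsProperHVF (region I U) (kasnerMetric φ a) (kasnerHVF φ a) φ := by
  refine ⟨(isHVF_kasnerMetric_iff h hI0).2 ⟨fun c => ?_, fun p hp => ?_, fun p hp μ => ?_,
    fun p hp μ ν hμν => ?_, fun p hp μ => ?_⟩, hφ⟩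
  · refine Fin.cases ?_ (fun κ => ?_) c
    · simp only [kasnerHVF, Fin.cons_zero]
      exact ContDiff.contDiffOn (by fun_prop)
    · simp only [kasnerHVF, Fin.cons_succ]
      exact ContDiff.contDiffOn (by fun_prop)
  · simp [kasnerHVF, pd_const_mul_coord]
  · simp [kasnerHVF, pd_const_mul_coord, (Fin.succ_ne_zero μ).symm]
  · simp [kasnerHVF, pd_const_mul_coord, hμν, hμν.symm]
  · simp only [kasnerHVF, Fin.cons_zero, Fin.cons_succ, pd_const_mul_coord, if_true]
    have := time_mul_deriv_rpow (m := 2 * ((φ - a μ) / φ)) (hI0 hp.1)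
    rw [mul_assoc φ, this]
    field_simp
    ring

lemma eq_kasnerHVF_of_isProperHVF (hφ : φ ≠ 0) (ha : Function.Injective a)
    (h : IsAdmissible I U) (hI0 : I ⊆ Set.Ioi 0) {Z : VField} {ψ : ℝ}
    (hZ : IsProperHVF (region I U) (kasnerMetric φ a) Z ψ) :
    ∃ s : Fin 3 → ℝ, ∀ p ∈ region I U,
      Z p = (ψ / φ) • kasnerHVF φ a p + translation s := by
  have hne : ∀ μ ν : Fin 3, μ ≠ ν → ∀ C : ℝ,
      ¬ ∀ t ∈ I, t ^ (2 * ((φ - a μ) / φ)) = C * t ^ (2 * ((φ - a ν) / φ)) := fun μ ν hμν =>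
    rpow_not_proportional h.isOpen_time h.isConnected_time.nonempty hI0
      ((kasner_exponent_injective hφ ha).ne hμν)
  have hpos : ∀ (μ : Fin 3), ∀ t ∈ I, 0 < t ^ (2 * ((φ - a μ) / φ)) := fun μ t ht =>
    Real.rpow_pos_of_pos (hI0 ht) _
  have hb : ∀ μ : Fin 3, ContDiffOn ℝ ∞ (fun t : ℝ => t ^ (2 * ((φ - a μ) / φ))) I :=
    fun μ => contDiffOn_rpow_Ioi hI0
  have E := (isHVF_kasnerMetric_iff h hI0).1 hZ.1
  obtain ⟨r, c, s, haff, hode⟩ := E.exists_affine h hpos hne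
    fun ν p hp => E.pd_time_eq_zero h hb hZ.2 hpos hne ν hp
  have hlin : ∀ μ, ∀ t ∈ I, (ψ * t + r) * (φ - a μ) = (ψ - c μ) * φ * t := fun μ t ht => by
    have e := hode μ t ht
    have e' := time_mul_deriv_rpow (m := 2 * ((φ - a μ) / φ)) (hI0 ht)
    have h2 : (ψ * t + r) * (2 * ((φ - a μ) / φ)) = 2 * (ψ - c μ) * t := by
      refine mul_right_cancel₀ (hpos μ t ht).ne' ?_
      linear_combination t * e - (ψ * t + r) * e'
    field_simp at h2
    linear_combination h2
  obtain ⟨t₁, ht₁⟩ := h.isConnected_time.nonempty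
  obtain ⟨x, hx, y, hy, hxy⟩ :=
    (infinite_of_mem_nhds t₁ (h.isOpen_time.mem_nhds ht₁)).nontrivial
  -- `hlin` is affine in `t` and holds at two distinct times, so its constant term vanishes. Not all
  -- `a_μ` equal `φ`, hence `r = 0`.
  have hra : ∀ μ, r * (φ - a μ) = 0 := fun μ => by
    refine mul_left_cancel₀ (sub_ne_zero.2 hxy) ?_
    linear_combination x * hlin μ y hy - y * hlin μ x hx
  have hr : r = 0 := by
    by_contra hr
    have hφa : ∀ μ, a μ = φ := fun μ => by
      have : φ - a μ = 0 := by simpa [hr] using hra μ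
      linarith
    exact absurd (ha ((hφa 0).trans (hφa 1).symm)) (by decide)
  have hc : ∀ μ, c μ = ψ / φ * a μ := fun μ => by
    have e := hlin μ x hx
    have hx0 : x ≠ 0 := ne_of_gt (hI0 hx)
    rw [hr] at e
    field_simp
    refine mul_left_cancel₀ hx0 ?_
    linear_combination e
  refine ⟨s, fun p hp => funext fun d => ?_⟩
  obtain ⟨hZ0, hZμ⟩ := haff p hp
  refine Fin.cases ?_ (fun μ => ?_) d
  · simp only [kasnerHVF, translation, Pi.add_apply, Pi.smul_apply, smul_eq_mul, Fin.cons_zero]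
    rw [hZ0, hr]
    field_simp
  · simp only [kasnerHVF, translation, Pi.add_apply, Pi.smul_apply, smul_eq_mul, Fin.cons_succ]
    rw [hZμ, hc]
    ring

end Kasner

end BianchiI

theorem proposition1 :
    -- only Kasner-type metrics admit a proper homothetic vector field, which is the stated one
    (∀ (I : Set ℝ) (U : Set (Fin 3 → ℝ)) (g : BianchiI.MetricField),
      BianchiI.IsProperDiagonal I U g →
      ∀ (Y : BianchiI.VField) (φ : ℝ), BianchiI.IsProperHVF (BianchiI.region I U) g Y φ →
        ∃ a : Fin 3 → ℝ, Function.Injective a ∧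
        ∃ (ε t₀ : ℝ) (k s : Fin 3 → ℝ), (ε = 1 ∨ ε = -1) ∧ (∀ μ, 0 < k μ) ∧
          ∀ p ∈ BianchiI.region I U,
            0 < BianchiI.coordChange ε t₀ k p 0 ∧
            g p = BianchiI.pullback (BianchiI.coordChange ε t₀ k) (BianchiI.kasnerMetric φ a) p ∧
            fderiv ℝ (BianchiI.coordChange ε t₀ k) p (Y p) =
              BianchiI.kasnerHVF φ a (BianchiI.coordChange ε t₀ k p) + BianchiI.translation s) ∧
    -- the Kasner-type metrics are proper diagonal Bianchi I and do admit it, uniquely up to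
    -- constant multiples and the translational Killing vector fields
    (∀ (φ : ℝ) (a : Fin 3 → ℝ), φ ≠ 0 → Function.Injective a →
      ∀ (I : Set ℝ) (U : Set (Fin 3 → ℝ)), BianchiI.IsAdmissible I U → I ⊆ Set.Ioi 0 →
        BianchiI.IsProperDiagonal I U (BianchiI.kasnerMetric φ a) ∧
        BianchiI.IsProperHVF (BianchiI.region I U) (BianchiI.kasnerMetric φ a)
          (BianchiI.kasnerHVF φ a) φ ∧
        ∀ (Z : BianchiI.VField) (ψ : ℝ),
          BianchiI.IsProperHVF (BianchiI.region I U) (BianchiI.kasnerMetric φ a) Z ψ →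
          ∃ s : Fin 3 → ℝ, ∀ p ∈ BianchiI.region I U,
            Z p = (ψ / φ) • BianchiI.kasnerHVF φ a p + BianchiI.translation s) := by
  exact ⟨fun I U g hg Y φ hY => BianchiI.exists_kasner_of_isProperHVF hg hY,
    fun φ a hφ ha I U h hI0 => ⟨BianchiI.isProperDiagonal_kasnerMetric hφ ha h hI0,
      BianchiI.isProperHVF_kasnerHVF hφ h hI0,
      fun Z ψ hZ => BianchiI.eq_kasnerHVF_of_isProperHVF hφ ha h hI0 hZ⟩⟩
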